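/- All alphabets are finite. A two-way channel $p(y_1,y_2|x_1,x_2)$ assigns to each pair of inputs $(x_1,x_2)\in\mathcal X_1\times\mathcal X_2$ a probability distribution on $\mathcal Y_1\times\mathcal Y_2$; party $i\in\{1,2\}$ chooses $x_i$ and observes $y_i$. Repeated uses of the channel are memoryless. **Zero capacity.** A code of length $n$ with message sets of sizes $M_1,M_2$ consists of encoders giving the $j$-th input of party $i$ as a function of its message $m_i$ and its outputs $y_{i,1},\dots,y_{i,j-1}$, and of decoders giving party $i$'s guess of the other party's message as a function of $m_i$ and $y_{i,1},\dots,y_{i,n}$. A pair $(R_1,R_2)$ with $R_1,R_2\ge 0$ is achievable if there are codes of lengths $n=0,1,2,\dots$ with $M_i=2^{\lceil nR_i\rceil}$ for which the probability, for uniformly distributed $(m_1,m_2)$, that at least one guess is wrong tends to $0$. The capacity region of $p$ is the closure of the set of achievable pairs, and $p$ has zero capacity if this region is $\{(0,0)\}$. **Simulation.** A simulation protocol with feedback and local randomness, using $p$ for $n$ times, works as follows. Party $i$ is given $\tilde x_i$. For $j=1,\dots,n$ it draws the input $X_{i,j}$ of the $j$-th use of $p$ from a conditional distribution depending on $(\tilde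 x_i,X_{i,1},\dots,X_{i,j-1},Y_{i,1},\dots,Y_{i,j-1})$ and then receives $Y_{i,j}$. At the end it draws $\tilde Y_i$ from a conditional distribution depending on $(\tilde x_i,X_{i,1},\dots,X_{i,n},Y_{i,1},\dots,Y_{i,n})$. The random choices of the two parties are independent of each other given what each of them has seen. A single copy of a two-way channel $q(\tilde y_1,\tilde y_2|\tilde x_1,\tilde x_2)$ can be simulated from arbitrarily many uses of $p$ if for every $\epsilon>0$ there are an $n$ and such a protocol, whose induced conditional distribution of $(\tilde Y_1,\tilde Y_2)$ differs from $q(\tilde y_1,\tilde y_2|\tilde x_1,\tilde x_2)$ by at most $\epsilon$ for all $\tilde x_1,\tilde x_2,\tilde y_1,\tilde y_2$. **The region.** For a pair $(Y_1,Y_2)$ of random variables and real $\lambda_1,\lambda_2$ put $$G^z_{\lambda_1,\lambda_2}(Y_1,Y_2)=\sup_{p(u|y_1,y_2)}\bigl[-I(U;Y_1Y_2)+\lambda_1 I(U;Y_1)+\lambda_2 I(U;Y_2)\bigr],$$ the supremum being over all auxiliary random variables $U$ with a finite alphabet. For a two-way channel $p$ let $G^z_{\lambda_1,\lambda_2}(p)=\max_{x_1,x_2}G^z_{\lambda_1,\lambda_2}(Y_1,Y_2)$,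 where $(Y_1,Y_2)\sim p(\cdot,\cdot|x_1,x_2)$, and let $$\Upsilon^z(p)=\{(\lambda_1,\lambda_2)\in[0,1]^2 \mid G^z_{\lambda_1,\lambda_2}(p)\le 0\}.$$ **Theorem.** Let $p$ and $q$ be two-way channels such that $p$ has zero capacity. If a single copy of $q$ can be simulated, with feedback and local randomness, from arbitrarily many uses of $p$, then $\Upsilon^z(p)\subseteq\Upsilon^z(q)$. -/

import Mathlib

open Filter Topology

noncomputable section

namespace TwoWay

/-! ### Entropy and mutual information on finite alphabets -/

/-- Shannon entropy (in nats) of a distribution on a finite alphabet. -/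
def entropy {α : Type*} [Fintype α] (r : PMF α) : ℝ :=
  ∑ a, Real.negMulLog (r a).toReal

/-- Mutual information `I(A;B) = H(A) + H(B) - H(A,B)` of a joint distribution of `(A, B)`. -/
def mutualInfo {α β : Type*} [Fintype α] [Fintype β] (r : PMF (α × β)) : ℝ :=
  entropy (r.map Prod.fst) + entropy (r.map Prod.snd) - entropy r

/-- The joint distribution of `(U, V)` when `V ∼ r` and `U` is drawn from `K(· | V)`. -/
def withAux {U V : Type*} (r : PMF V) (K : V → PMF U) : PMF (U × V) :=
  r.bind fun v => (K v).map fun u => (u, v)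

/-! ### Two-way channels and their interactive use -/

/-- A two-way channel `p(y₁, y₂ | x₁, x₂)`. -/
abbrev Channel (X₁ X₂ Y₁ Y₂ : Type*) := X₁ → X₂ → PMF (Y₁ × Y₂)

/-- What a party has seen after `n` channel uses: its own inputs and outputs at times
`0, …, n - 1`. -/
abbrev History (X Y : Type*) (n : ℕ) := Fin n → X × Y

/-- A randomized strategy of one party: the conditional law of its input at time `j`, given its own
inputs and outputs at the times before `j`. -/
abbrev Strategy (X Y : Type*) := (j : ℕ) → History X Y j → PMF X

variable {X₁ X₂ Y₁ Y₂ A₁ A₂ B₁ B₂ : Type*}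

/-- The joint law of the two histories after `n` uses of the memoryless channel `p`, when the
parties use the strategies `f₁` and `f₂`. Given the past, the two inputs are drawn independently of
each other, each from its own party's history. -/
def interact (p : Channel X₁ X₂ Y₁ Y₂) (f₁ : Strategy X₁ Y₁) (f₂ : Strategy X₂ Y₂) :
    (n : ℕ) → PMF (History X₁ Y₁ n × History X₂ Y₂ n)
  | 0 => PMF.pure (Fin.elim0, Fin.elim0)
  | n + 1 =>
    (interact p f₁ f₂ n).bind fun h =>
      (f₁ n h.1).bind fun x₁ =>
        (f₂ n h.2).bind fun x₂ =>
          (p x₁ x₂).map fun y =>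
            (Fin.snoc (α := fun _ => X₁ × Y₁) h.1 (x₁, y.1),
              Fin.snoc (α := fun _ => X₂ × Y₂) h.2 (x₂, y.2))

/-! ### The capacity region -/

/-- A block code of length `n` for a two-way channel, with `M₁` messages of party 1 and `M₂`
messages of party 2. The input of a party at time `j` is a function of its message and of its
channel outputs before time `j` (only the times `j < n` are used). At the end each party guesses the
other party's message from its own message and its `n` channel outputs. -/
structure Code (X₁ X₂ Y₁ Y₂ : Type*) (M₁ M₂ n : ℕ) where
  enc₁ : Fin M₁ → (j : ℕ) → (Fin j → Y₁) → X₁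
  enc₂ : Fin M₂ → (j : ℕ) → (Fin j → Y₂) → X₂
  dec₁ : Fin M₁ → (Fin n → Y₁) → Fin M₂
  dec₂ : Fin M₂ → (Fin n → Y₂) → Fin M₁

/-- The joint law of the two histories when the messages are `m₁` and `m₂`. -/
def Code.law {M₁ M₂ n : ℕ} (c : Code X₁ X₂ Y₁ Y₂ M₁ M₂ n) (p : Channel X₁ X₂ Y₁ Y₂)
    (m₁ : Fin M₁) (m₂ : Fin M₂) : PMF (History X₁ Y₁ n × History X₂ Y₂ n) :=
  interact p
    (fun j h => PMF.pure (c.enc₁ m₁ j fun i => (h i).2))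
    (fun j h => PMF.pure (c.enc₂ m₂ j fun i => (h i).2)) n

/-- The probability that at least one of the two messages is decoded incorrectly, when the message
pair is uniformly distributed. -/
def Code.errorProb {M₁ M₂ n : ℕ} (c : Code X₁ X₂ Y₁ Y₂ M₁ M₂ n)
    (p : Channel X₁ X₂ Y₁ Y₂) : ℝ :=
  (∑ m₁, ∑ m₂, ((c.law p m₁ m₂).toOuterMeasure
      {h | c.dec₁ m₁ (fun i => (h.1 i).2) ≠ m₂ ∨ c.dec₂ m₂ (fun i => (h.2 i).2) ≠ m₁}).toReal)
    / ((M₁ : ℝ) * (M₂ : ℝ))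

/-- The rate pair `R` (in bits per channel use) is achievable: there are codes of lengths
`n = 0, 1, 2, …` with `2 ^ ⌈n R₁⌉` and `2 ^ ⌈n R₂⌉` messages whose error probability tends to zero. -/
def Achievable (p : Channel X₁ X₂ Y₁ Y₂) (R : ℝ × ℝ) : Prop :=
  0 ≤ R.1 ∧ 0 ≤ R.2 ∧
    ∃ c : (n : ℕ) → Code X₁ X₂ Y₁ Y₂ (2 ^ ⌈n * R.1⌉₊) (2 ^ ⌈n * R.2⌉₊) n,
      Tendsto (fun n => (c n).errorProb p) atTop (𝓝 0)

/-- The capacity region: the closure of the set of achievable rate pairs. -/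
def capacityRegion (p : Channel X₁ X₂ Y₁ Y₂) : Set (ℝ × ℝ) :=
  closure {R | Achievable p R}

/-- The channel has zero capacity. -/
def ZeroCapacity (p : Channel X₁ X₂ Y₁ Y₂) : Prop :=
  capacityRegion p = {(0, 0)}

/-! ### Channel simulation -/

/-- A protocol with feedback and local randomness that uses a two-way channel with alphabets
`X₁, X₂, Y₁, Y₂` for `n` times, and whose aim is to simulate a channel with input alphabets
`A₁, A₂` and output alphabets `B₁, B₂`. Party `i` receives `aᵢ`, draws each channel input from a law
depending on `aᵢ` and its own past inputs and outputs, and in the end draws its output in `Bᵢ` from a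
law depending on `aᵢ` and its own `n` inputs and outputs. -/
structure SimCode (X₁ X₂ Y₁ Y₂ A₁ A₂ B₁ B₂ : Type*) (n : ℕ) where
  enc₁ : A₁ → Strategy X₁ Y₁
  enc₂ : A₂ → Strategy X₂ Y₂
  dec₁ : A₁ → History X₁ Y₁ n → PMF B₁
  dec₂ : A₂ → History X₂ Y₂ n → PMF B₂

/-- The channel induced by a simulation protocol: the joint law of the two final outputs given
the inputs `a₁` and `a₂`. -/
def SimCode.induced {n : ℕ} (c : SimCode X₁ X₂ Y₁ Y₂ A₁ A₂ B₁ B₂ n)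
    (p : Channel X₁ X₂ Y₁ Y₂) : Channel A₁ A₂ B₁ B₂ := fun a₁ a₂ =>
  (interact p (c.enc₁ a₁) (c.enc₂ a₂) n).bind fun h =>
    (c.dec₁ a₁ h.1).bind fun b₁ => (c.dec₂ a₂ h.2).map fun b₂ => (b₁, b₂)

/-- A single copy of `q` can be simulated, to arbitrary accuracy, from arbitrarily many uses
of `p`. -/
def CanSimulate (p : Channel X₁ X₂ Y₁ Y₂) (q : Channel A₁ A₂ B₁ B₂) : Prop :=
  ∀ ε : ℝ, 0 < ε → ∃ (n : ℕ) (c : SimCode X₁ X₂ Y₁ Y₂ A₁ A₂ B₁ B₂ n),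
    ∀ a₁ a₂ b, |(c.induced p a₁ a₂ b).toReal - (q a₁ a₂ b).toReal| ≤ ε

/-! ### The function `G^z` and the region `Υ^z` -/

/-- `-I(U; Y₁Y₂) + λ₁ I(U; Y₁) + λ₂ I(U; Y₂)`, where `(Y₁, Y₂) ∼ r` and `U` is drawn from
`K(· | Y₁, Y₂)`. -/
def gValue {U : Type*} [Fintype U] [Fintype Y₁] [Fintype Y₂] (l₁ l₂ : ℝ) (r : PMF (Y₁ × Y₂))
    (K : Y₁ × Y₂ → PMF U) : ℝ :=
  - mutualInfo (withAux r K)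
    + l₁ * mutualInfo ((withAux r K).map fun w => (w.1, w.2.1))
    + l₂ * mutualInfo ((withAux r K).map fun w => (w.1, w.2.2))

/-- `G^z_{λ₁, λ₂}(Y₁, Y₂)` for `(Y₁, Y₂) ∼ r`: the supremum over all auxiliary variables `U` with
values in a finite alphabet, taken in the extended reals. -/
def gDist [Fintype Y₁] [Fintype Y₂] (l₁ l₂ : ℝ) (r : PMF (Y₁ × Y₂)) : EReal :=
  ⨆ (k : ℕ) (K : Y₁ × Y₂ → PMF (Fin k)), (gValue l₁ l₂ r K : EReal)

/-- `G^z_{λ₁, λ₂}` of a two-way channel: the supremum over the inputs `x₁, x₂` of `G^z` of the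
output distribution. -/
def gChannel [Fintype Y₁] [Fintype Y₂] (l₁ l₂ : ℝ) (p : Channel X₁ X₂ Y₁ Y₂) : EReal :=
  ⨆ (x₁ : X₁) (x₂ : X₂), gDist l₁ l₂ (p x₁ x₂)

/-- The region `Υ^z(p)` of all `(λ₁, λ₂) ∈ [0, 1]²` with `G^z_{λ₁, λ₂}(p) ≤ 0`. -/
def upsilon [Fintype Y₁] [Fintype Y₂] (p : Channel X₁ X₂ Y₁ Y₂) : Set (ℝ × ℝ) :=
  {l | l.1 ∈ Set.Icc (0 : ℝ) 1 ∧ l.2 ∈ Set.Icc (0 : ℝ) 1 ∧ gChannel l.1 l.2 p ≤ 0}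

end TwoWay

end

namespace TwoWay

/-! ### Finite probability mass functions with real weights -/

section Real

variable {α β γ : Type*}

/-! Fix `λ₁, λ₂ ∈ [0, 1]` and call a joint law good if its `G^z` is at most zero (`GNonpos`).
Independent pairs are good (`GNonpos.prod`), and goodness survives local processing (`GNonpos.map`)
and limits of laws (`GNonpos.of_tendsto`).

The core is `GNonpos.extend`: goodness passes from `(S₁, S₂)` to `((S₁, T₁), (S₂, T₂))` when every
conditional law of `(T₁, T₂)` is good and that of `Tᵢ` depends on `Sᵢ` alone. The chain rule splits
`I(U; S T)` into `I(U; S) + I(U; T | S)`. As `T₁` is independent of `S₂` given `S₁`, `I(U; T₁ | S₁)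
≤ I(U; T₁ | S₁ S₂)`, and likewise for party 2. So the functional for the pair is at most the one for
`S` plus the average of those for `T` given `S`.

A protocol alternates local randomness, which is a product law, with channel uses, so its output law
is good if the channel is no-signalling with good outputs. Letting the simulation error tend to zero
gives the inclusion.

Zero capacity forces no-signalling (`ZeroCapacity.noSignalling`): if one party's input influenced
the other's marginal, two such inputs would form a binary channel with distinct output laws, and
`exists_binary_code` would give a positive rate. -/

theorem sum_toReal [Fintype α] (r : PMF α) : ∑ a, (r a).toReal = 1 := by
  rw [← ENNReal.toReal_sum fun a _ => r.apply_ne_top a, ← tsum_fintype (L := .unconditional _),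
    r.tsum_coe, ENNReal.toReal_one]

theorem toReal_bind_apply [Fintype α] (r : PMF α) (f : α → PMF β) (b : β) :
    (r.bind f b).toReal = ∑ a, (r a).toReal * (f a b).toReal := by
  rw [PMF.bind_apply, tsum_fintype, ENNReal.toReal_sum fun a _ =>
    ENNReal.mul_ne_top (r.apply_ne_top a) ((f a).apply_ne_top b)]
  simp only [ENNReal.toReal_mul]

open Classical in
theorem toReal_map_apply [Fintype α] (r : PMF α) (f : α → β) (b : β) :
    (r.map f b).toReal = ∑ a, if f a = b then (r a).toReal else 0 := by
  rw [PMF.map, toReal_bind_apply]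
  refine Finset.sum_congr rfl fun a _ => ?_
  by_cases h : f a = b
  · simp [h]
  · simp [h, Ne.symm h]

theorem toReal_map_injective [Fintype α] (r : PMF α) {f : α → β} (hf : f.Injective) (a : α) :
    (r.map f (f a)).toReal = (r a).toReal := by
  classical
  rw [toReal_map_apply, Finset.sum_eq_single a] <;> simp +contextual [hf.eq_iff]

theorem toReal_map_of_notMem_range [Fintype α] (r : PMF α) {f : α → β} {b : β}
    (hb : b ∉ Set.range f) : (r.map f b).toReal = 0 := by
  classical
  rw [toReal_map_apply]
  exact Finset.sum_eq_zero fun a _ => if_neg fun h => hb ⟨a, h⟩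

theorem sum_toReal_map_mul [Fintype α] [Fintype β] (r : PMF α) (f : α → β) (F : β → ℝ) :
    ∑ b, (r.map f b).toReal * F b = ∑ a, (r a).toReal * F (f a) := by
  classical
  simp only [toReal_map_apply, Finset.sum_mul]
  rw [Finset.sum_comm]
  simp

/-- The joint law of `S ∼ r` and of `T ∼ W(· | S)`. -/
noncomputable def compProd (r : PMF α) (W : α → PMF β) : PMF (α × β) :=
  r.bind fun s => (W s).map fun t => (s, t)

theorem toReal_compProd_apply [Fintype α] [Fintype β] (r : PMF α) (W : α → PMF β) (s : α) (t : β) :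
    (compProd r W (s, t)).toReal = (r s).toReal * (W s t).toReal := by
  classical
  rw [compProd, toReal_bind_apply, Finset.sum_eq_single s]
  · rw [toReal_map_injective _ (Prod.mk_right_injective s)]
  · intro s' _ h
    rw [toReal_map_of_notMem_range _ (by simp [h]), mul_zero]
  · simp

theorem compProd_map_fst (r : PMF α) (W : α → PMF β) : (compProd r W).map Prod.fst = r := by
  have h : ∀ s, (W s).map (fun _ => s) = PMF.pure s := fun s => PMF.map_const _ _
  simp [compProd, PMF.map_bind, PMF.map_comp, Function.comp_def, h]

theorem compProd_map_snd (r : PMF α) (W : α → PMF β) : (compProd r W).map Prod.snd = r.bind W := by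
  have h : ∀ s, (W s).map (fun t => t) = W s := fun s => (W s).map_id
  simp [compProd, PMF.map_bind, PMF.map_comp, Function.comp_def, h]

end Real

/-! ### Entropy -/

section Entropy

variable {α β γ Ω Ω' : Type*} [Fintype α] [Fintype β] [Fintype γ]

theorem entropy_map_injective (r : PMF α) {f : α → β} (hf : f.Injective) :
    entropy (r.map f) = entropy r := by
  refine (Fintype.sum_of_injective f hf _ _ (fun b hb => ?_) fun a => ?_).symm
  · rw [toReal_map_of_notMem_range _ hb, Real.negMulLog_zero]
  · rw [toReal_map_injective _ hf]

/-- Chain rule for entropy; it comes from the product rule for `-x log x`. -/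
theorem entropy_compProd (r : PMF α) (W : α → PMF β) :
    entropy (compProd r W) = entropy r + ∑ s, (r s).toReal * entropy (W s) := by
  rw [entropy, Fintype.sum_prod_type, entropy, ← Finset.sum_add_distrib]
  refine Finset.sum_congr rfl fun s _ => ?_
  simp only [toReal_compProd_apply, Real.negMulLog_mul, Finset.sum_add_distrib, ← Finset.sum_mul,
    ← Finset.mul_sum, sum_toReal, one_mul, entropy]

/-- The entropy of a random variable on a finite probability space. -/
noncomputable def entropyOf (μ : PMF Ω) (X : Ω → α) : ℝ := entropy (μ.map X)

theorem entropyOf_map (μ : PMF Ω) (Z : Ω → Ω') (X : Ω' → α) :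
    entropyOf (μ.map Z) X = entropyOf μ fun ω => X (Z ω) := by
  rw [entropyOf, PMF.map_comp]; rfl

theorem entropyOf_comp_injective (μ : PMF Ω) (X : Ω → α) {f : α → β} (hf : f.Injective) :
    entropyOf μ (fun ω => f (X ω)) = entropyOf μ X := by
  rw [entropyOf, entropyOf, ← entropy_map_injective (μ.map X) hf, PMF.map_comp]; rfl

theorem entropyOf_compProd (r : PMF α) (V : α → PMF Ω) (X : Ω → β) :
    entropyOf (compProd r V) (fun z => (z.1, X z.2)) =
      entropy r + ∑ s, (r s).toReal * entropyOf (V s) X := by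
  have h : (compProd r V).map (fun z => (z.1, X z.2)) = compProd r fun s => (V s).map X := by
    simp [compProd, PMF.map_bind, PMF.map_comp, Function.comp_def]
  rw [entropyOf, h, entropy_compProd]
  rfl

/-- Subadditivity of entropy for a nonnegative matrix of arbitrary total mass; the term in the total
mass corrects for the missing normalization. It is needed unnormalized because it is applied to each
slice `Y = b` of a joint law. -/
theorem negMulLog_sum_add_le (p : α → γ → ℝ) (hp : ∀ a c, 0 ≤ p a c) :
    ∑ a, ∑ c, Real.negMulLog (p a c) + Real.negMulLog (∑ a, ∑ c, p a c) ≤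
      ∑ a, Real.negMulLog (∑ c, p a c) + ∑ c, Real.negMulLog (∑ a, p a c) := by
  set T := ∑ a, ∑ c, p a c with hT
  have hT' : T = ∑ c, ∑ a, p a c := by rw [hT, Finset.sum_comm]
  have hrow : ∀ a, 0 ≤ ∑ c, p a c := fun a => Finset.sum_nonneg fun c _ => hp a c
  have hcol : ∀ c, 0 ≤ ∑ a, p a c := fun c => Finset.sum_nonneg fun a _ => hp a c
  have hle : ∀ a c, p a c ≤ ∑ c, p a c := fun a c =>
    Finset.single_le_sum (f := fun c => p a c) (fun c _ => hp a c) (Finset.mem_univ c)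
  have hle' : ∀ a c, p a c ≤ ∑ a, p a c := fun a c =>
    Finset.single_le_sum (f := fun a => p a c) (fun a _ => hp a c) (Finset.mem_univ a)
  have hleT : ∀ a c, p a c ≤ T := fun a c => (hle a c).trans
    (Finset.single_le_sum (f := fun a => ∑ c, p a c) (fun a _ => hrow a) (Finset.mem_univ a))
  have key : ∀ a c, p a c - (∑ c, p a c) * (∑ a, p a c) / T ≤
      p a c * Real.log (p a c) + p a c * Real.log T - p a c * Real.log (∑ c, p a c)
        - p a c * Real.log (∑ a, p a c) := by
    intro a c
    rcases (hp a c).eq_or_lt with h | h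
    · simp only [← h, zero_mul, zero_sub, sub_zero, add_zero, neg_nonpos]
      exact div_nonneg (mul_nonneg (hrow a) (hcol c)) (h.trans_le (hleT a c))
    · have h1 := h.trans_le (hle a c)
      have h2 := h.trans_le (hle' a c)
      have h3 := h.trans_le (hleT a c)
      -- `log x ≤ x - 1` at the ratio of the product of the marginals to the joint weight, as in the
      -- proof that relative entropy is nonnegative.
      have := Real.log_le_sub_one_of_pos (div_pos (mul_pos h1 h2) (mul_pos h h3))
      rw [Real.log_div (by positivity) (by positivity), Real.log_mul h1.ne' h2.ne',
        Real.log_mul h.ne' h3.ne'] at this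
      have h4 := mul_le_mul_of_nonneg_left this h.le
      have h5 : p a c * ((∑ c, p a c) * (∑ a, p a c) / (p a c * T) - 1) =
          (∑ c, p a c) * (∑ a, p a c) / T - p a c := by
        field_simp
      rw [h5] at h4
      linarith
  have hsum := Finset.sum_le_sum fun a (_ : a ∈ Finset.univ) =>
    Finset.sum_le_sum fun c (_ : c ∈ Finset.univ) => key a c
  have hleft : ∑ a, ∑ c, (p a c - (∑ c, p a c) * (∑ a, p a c) / T) = 0 := by
    simp only [Finset.sum_sub_distrib, ← Finset.sum_div, ← Finset.mul_sum, ← hT']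
    -- `T * T / T = T` also holds for `T = 0`, so zero mass needs no separate case.
    rw [← Finset.sum_mul, ← hT, mul_self_div_self, sub_self]
  have h1 : ∑ a, ∑ c, p a c * Real.log (∑ c, p a c) =
      -∑ a, Real.negMulLog (∑ c, p a c) := by
    simp [Real.negMulLog, Finset.sum_mul]
  have h2 : ∑ a, ∑ c, p a c * Real.log (∑ a, p a c) =
      -∑ c, Real.negMulLog (∑ a, p a c) := by
    rw [Finset.sum_comm]; simp [Real.negMulLog, Finset.sum_mul]
  have h3 : ∑ a, ∑ c, p a c * Real.log T = - Real.negMulLog T := by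
    simp only [Real.negMulLog, ← Finset.sum_mul, ← hT]; ring
  have h4 : ∑ a, ∑ c, p a c * Real.log (p a c) = -∑ a, ∑ c, Real.negMulLog (p a c) := by
    simp [Real.negMulLog]
  rw [hleft] at hsum
  simp only [Finset.sum_sub_distrib, Finset.sum_add_distrib] at hsum
  rw [h1, h2, h3, h4] at hsum
  linarith

/-- This is `I(X; Z | Y) ≥ 0`, proved slice by slice in the value of `Y`. All information
inequalities below are instances of it. -/
theorem entropyOf_submodular [Fintype Ω] (μ : PMF Ω) (X : Ω → α) (Y : Ω → β) (Z : Ω → γ) :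
    entropyOf μ (fun ω => (X ω, Y ω, Z ω)) + entropyOf μ Y ≤
      entropyOf μ (fun ω => (X ω, Y ω)) + entropyOf μ (fun ω => (Y ω, Z ω)) := by
  classical
  set r := μ.map fun ω => (X ω, Y ω, Z ω) with hr
  have hY : μ.map Y = r.map fun w => w.2.1 := by rw [hr, PMF.map_comp]; rfl
  have hXY : μ.map (fun ω => (X ω, Y ω)) = r.map fun w => (w.1, w.2.1) := by
    rw [hr, PMF.map_comp]; rfl
  have hYZ : μ.map (fun ω => (Y ω, Z ω)) = r.map fun w => w.2 := by rw [hr, PMF.map_comp]; rfl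
  simp only [entropyOf, hY, hXY, hYZ, ← hr]
  have e1 : entropy r = ∑ b, ∑ a, ∑ c, Real.negMulLog (r (a, b, c)).toReal := by
    rw [entropy, Fintype.sum_prod_type, Finset.sum_comm' (t' := Finset.univ)
      (s' := fun _ => Finset.univ) (by simp)]
    rw [Fintype.sum_prod_type]
    exact Finset.sum_congr rfl fun b _ => Finset.sum_comm
  have e2 : entropy (r.map fun w => w.2.1) =
      ∑ b, Real.negMulLog (∑ a, ∑ c, (r (a, b, c)).toReal) := by
    simp only [entropy, toReal_map_apply]
    simp only [Fintype.sum_prod_type]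
    refine Finset.sum_congr rfl fun b _ => congrArg _ (Finset.sum_congr rfl fun a _ => ?_)
    rw [Finset.sum_comm]
    simp
  have e3 : entropy (r.map fun w => (w.1, w.2.1)) =
      ∑ b, ∑ a, Real.negMulLog (∑ c, (r (a, b, c)).toReal) := by
    rw [entropy, Fintype.sum_prod_type, Finset.sum_comm]
    simp only [toReal_map_apply]
    simp [Fintype.sum_prod_type, Prod.ext_iff, ite_and]
    refine Finset.sum_congr rfl fun b _ => Finset.sum_congr rfl fun a _ => congrArg _ ?_
    rw [Finset.sum_comm]
    simp
  have e4 : entropy (r.map fun w => w.2) =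
      ∑ b, ∑ c, Real.negMulLog (∑ a, (r (a, b, c)).toReal) := by
    rw [entropy, Fintype.sum_prod_type]
    simp only [toReal_map_apply]
    simp [Fintype.sum_prod_type, Prod.ext_iff, ite_and]
  rw [e1, e2, e3, e4, ← Finset.sum_add_distrib, ← Finset.sum_add_distrib]
  exact Finset.sum_le_sum fun b _ =>
    negMulLog_sum_add_le (fun a c => (r (a, b, c)).toReal) fun _ _ => ENNReal.toReal_nonneg

theorem entropyOf_const (μ : PMF Ω) (a : α) : entropyOf μ (fun _ => a) = 0 := by
  classical
  have h : μ.map (fun _ => a) = PMF.pure a := PMF.map_const _ _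
  rw [entropyOf, h, entropy]
  refine Finset.sum_eq_zero fun b _ => ?_
  by_cases hb : b = a <;> simp [hb]

theorem entropyOf_pair_le [Fintype Ω] (μ : PMF Ω) (X : Ω → α) (Z : Ω → γ) :
    entropyOf μ (fun ω => (X ω, Z ω)) ≤ entropyOf μ X + entropyOf μ Z := by
  have h := entropyOf_submodular μ X (fun _ => ()) Z
  rw [entropyOf_const, add_zero] at h
  rwa [entropyOf_comp_injective μ (fun ω => (X ω, Z ω)) (f := fun w => (w.1, (), w.2))
      fun _ _ h => by simpa [Prod.ext_iff] using h,
    entropyOf_comp_injective μ X (f := fun x => (x, ())) fun _ _ h => by simpa using h,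
    entropyOf_comp_injective μ Z (f := fun x => ((), x)) fun _ _ h => by simpa using h] at h

end Entropy

/-! ### Mutual information of random variables -/

section Info

variable {α β γ δ S S' T Ω Ω' Y₁ Y₂ : Type*} [Fintype α] [Fintype β] [Fintype γ] [Fintype δ]
  [Fintype S] [Fintype S'] [Fintype T] [Fintype Y₁] [Fintype Y₂]

/-- The mutual information of two random variables on a finite probability space. -/
noncomputable def infoOf (μ : PMF Ω) (X : Ω → α) (Y : Ω → β) : ℝ :=
  entropyOf μ X + entropyOf μ Y - entropyOf μ fun ω => (X ω, Y ω)

theorem infoOf_map (μ : PMF Ω) (Z : Ω → Ω') (X : Ω' → α) (Y : Ω' → β) :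
    infoOf (μ.map Z) X Y = infoOf μ (fun ω => X (Z ω)) fun ω => Y (Z ω) := by
  simp only [infoOf, entropyOf_map]

theorem infoOf_nonneg [Fintype Ω] (μ : PMF Ω) (X : Ω → α) (Y : Ω → β) : 0 ≤ infoOf μ X Y := by
  have := entropyOf_pair_le μ X Y
  unfold infoOf
  linarith

theorem infoOf_comp_injective (μ : PMF Ω) (X : Ω → α) (Y : Ω → β) {f : β → γ} (hf : f.Injective) :
    infoOf μ X (fun ω => f (Y ω)) = infoOf μ X Y := by
  have h := entropyOf_comp_injective μ (fun ω => (X ω, Y ω)) (f := Prod.map id f)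
    (Function.injective_id.prodMap hf)
  simp only [Prod.map_apply, id] at h
  rw [infoOf, infoOf, entropyOf_comp_injective μ Y hf, h]

/-- Data processing for a deterministic map. -/
theorem infoOf_comp_le [Fintype Ω] (μ : PMF Ω) (X : Ω → α) (Y : Ω → β) (f : β → γ) :
    infoOf μ X (fun ω => f (Y ω)) ≤ infoOf μ X Y := by
  -- `I(X; Y | f(Y)) ≥ 0`.
  have h := entropyOf_submodular μ X (fun ω => f (Y ω)) Y
  have h1 := entropyOf_comp_injective μ (fun ω => (X ω, Y ω)) (f := fun w => (w.1, f w.2, w.2))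
    fun _ _ h => by simp_all [Prod.ext_iff]
  have h2 := entropyOf_comp_injective μ Y (f := fun w => (f w, w)) fun _ _ h => by
    simp_all [Prod.ext_iff]
  simp only at h1 h2
  unfold infoOf
  linarith

/-- Chain rule: the information of `(S, T)` about `U` is that of `S` plus the conditional one. -/
theorem infoOf_compProd (r : PMF S) (V : S → PMF Ω) (U : Ω → α) (X : Ω → β) :
    infoOf (compProd r V) (fun z => U z.2) (fun z => (z.1, X z.2)) =
      infoOf (compProd r V) (fun z => U z.2) Prod.fst + ∑ s, (r s).toReal * infoOf (V s) U X := by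
  have h1 := entropyOf_compProd r V X
  have h2 := entropyOf_compProd r V U
  have h3 := entropyOf_compProd r V fun ω => (U ω, X ω)
  have h4 := entropyOf_comp_injective (compProd r V) (fun z => (z.1, U z.2, X z.2))
    (f := fun w => (w.2.1, w.1, w.2.2)) fun _ _ h => by simp_all [Prod.ext_iff]
  have h5 := entropyOf_comp_injective (compProd r V) (fun z => (z.1, U z.2))
    (f := Prod.swap) Prod.swap_injective
  have h6 : entropyOf (compProd r V) Prod.fst = entropy r := by rw [entropyOf, compProd_map_fst]
  simp only [Prod.swap_prod_mk] at h4 h5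
  simp only [infoOf, mul_sub, mul_add, Finset.sum_sub_distrib, Finset.sum_add_distrib]
  linarith

/-- If the conditional law of `T` given `S` depends only on `π S`, then `(π S, T)` has at most the
information of `π S` about `U`, plus the conditional information of `T` about `U` given `S`. -/
theorem infoOf_compProd_le [Fintype Ω] (r : PMF S) (V : S → PMF Ω) (U : Ω → α) (X : Ω → β)
    (π : S → S') (W : S' → PMF β) (hW : ∀ s, (V s).map X = W (π s)) :
    infoOf (compProd r V) (fun z => U z.2) (fun z => (π z.1, X z.2)) ≤
      infoOf (compProd r V) (fun z => U z.2) (fun z => π z.1) +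
        ∑ s, (r s).toReal * infoOf (V s) U X := by
  set μ := compProd r V
  have hchain := infoOf_compProd r V U X
  have h1 := entropyOf_compProd r V X
  have hmap : μ.map (fun z => (π z.1, X z.2)) = compProd (r.map π) W := by
    simp [μ, compProd, PMF.map_bind, PMF.bind_map, Function.comp_def, ← hW, PMF.map_comp]
  -- The hypothesis `hW` makes `H(T | π S)` equal to `H(T | S)`.
  have h2 : entropyOf μ (fun z => (π z.1, X z.2)) =
      entropyOf μ (fun z => π z.1) + ∑ s, (r s).toReal * entropyOf (V s) X := by
    have hfst : μ.map (fun z => π z.1) = r.map π := by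
      rw [← compProd_map_fst r V, PMF.map_comp]; rfl
    rw [entropyOf, hmap, entropy_compProd, sum_toReal_map_mul, entropyOf, hfst]
    simp only [entropyOf, hW]
  -- Conditioning reduces entropy: `H(T | U, S) ≤ H(T | U, π S)`.
  have h3 := entropyOf_submodular μ (fun z => X z.2) (fun z => (U z.2, π z.1)) Prod.fst
  have h4 := entropyOf_comp_injective μ (fun z => (U z.2, z.1, X z.2))
    (f := fun w => (w.2.2, (w.1, π w.2.1), w.2.1)) fun _ _ h => by simp_all [Prod.ext_iff]
  have h5 := entropyOf_comp_injective μ (fun z => (U z.2, z.1))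
    (f := fun w => ((w.1, π w.2), w.2)) fun _ _ h => by simp_all [Prod.ext_iff]
  have h6 := entropyOf_comp_injective μ (fun z => (U z.2, π z.1, X z.2))
    (f := fun w => (w.2.2, (w.1, w.2.1))) fun _ _ h => by simp_all [Prod.ext_iff]
  have h7 : entropyOf μ Prod.fst = entropy r := by rw [entropyOf, compProd_map_fst]
  simp only at h4 h5 h6
  unfold infoOf at hchain ⊢
  linarith

/-- The quantity `-I(U; Y₁Y₂) + λ₁ I(U; Y₁) + λ₂ I(U; Y₂)` of random variables. -/
noncomputable def gOf (l₁ l₂ : ℝ) (μ : PMF Ω) (U : Ω → α) (X : Ω → β) (Y : Ω → γ) : ℝ :=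
  - infoOf μ U (fun ω => (X ω, Y ω)) + l₁ * infoOf μ U X + l₂ * infoOf μ U Y

theorem gValue_eq_gOf (l₁ l₂ : ℝ) (r : PMF (Y₁ × Y₂)) (K : Y₁ × Y₂ → PMF α) :
    gValue l₁ l₂ r K =
      gOf l₁ l₂ (withAux r K) Prod.fst (fun w => w.2.1) (fun w => w.2.2) := by
  have h : (withAux r K).map (fun w => (w.1, w.2.1, w.2.2)) = withAux r K := PMF.map_id _
  simp only [gValue, gOf, mutualInfo, infoOf, entropyOf, PMF.map_comp, Function.comp_def, h]

theorem gOf_map (l₁ l₂ : ℝ) (μ : PMF Ω) (Z : Ω → Ω') (U : Ω' → α) (X : Ω' → β) (Y : Ω' → γ) :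
    gOf l₁ l₂ (μ.map Z) U X Y =
      gOf l₁ l₂ μ (fun ω => U (Z ω)) (fun ω => X (Z ω)) (fun ω => Y (Z ω)) := by
  simp only [gOf, infoOf_map]

/-- `G^z_{λ₁, λ₂}` of a distribution is at most zero. -/
def GNonpos (l₁ l₂ : ℝ) (r : PMF (Y₁ × Y₂)) : Prop :=
  ∀ (k : ℕ) (K : Y₁ × Y₂ → PMF (Fin k)), gValue l₁ l₂ r K ≤ 0

theorem gDist_nonpos_iff (l₁ l₂ : ℝ) (r : PMF (Y₁ × Y₂)) :
    gDist l₁ l₂ r ≤ 0 ↔ GNonpos l₁ l₂ r := by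
  simp [gDist, GNonpos, iSup_le_iff]

theorem gChannel_nonpos_iff {X₁ X₂ : Type*} (l₁ l₂ : ℝ) (p : Channel X₁ X₂ Y₁ Y₂) :
    gChannel l₁ l₂ p ≤ 0 ↔ ∀ x₁ x₂, GNonpos l₁ l₂ (p x₁ x₂) := by
  simp [gChannel, iSup_le_iff, gDist_nonpos_iff]

/-- Independent random variables. -/
theorem GNonpos.prod {l₁ l₂ : ℝ} (h₁ : l₁ ≤ 1) (h₂ : l₂ ≤ 1) (r₁ : PMF Y₁) (r₂ : PMF Y₂) :
    GNonpos l₁ l₂ (compProd r₁ fun _ => r₂) := by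
  intro k K
  set r := compProd r₁ fun _ => r₂
  rw [gValue_eq_gOf, gOf]
  set μ := withAux r K with hμ
  have hsnd : μ.map Prod.snd = r := by
    have h : ∀ v, (K v).map (fun _ => v) = PMF.pure v := fun v => PMF.map_const _ _
    simp [hμ, withAux, PMF.map_bind, PMF.map_comp, Function.comp_def, h]
  have hpair : entropyOf μ (fun ω => (ω.2.1, ω.2.2)) = entropy r₁ + entropy r₂ := by
    change entropy (μ.map Prod.snd) = _
    rw [hsnd, entropy_compProd, ← Finset.sum_mul, sum_toReal, one_mul]
  have hX : entropyOf μ (fun ω => ω.2.1) = entropy r₁ := by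
    rw [← entropyOf_map μ Prod.snd Prod.fst, hsnd, entropyOf, compProd_map_fst]
  have hY : entropyOf μ (fun ω => ω.2.2) = entropy r₂ := by
    rw [← entropyOf_map μ Prod.snd Prod.snd, hsnd, entropyOf, compProd_map_snd, PMF.bind_const]
  -- `I(Y₁; Y₂ | U) ≥ 0`; with `Y₁`, `Y₂` independent this yields `I(U; Y₁) + I(U; Y₂) ≤ I(U; Y₁
  -- Y₂)`.
  have h := entropyOf_submodular μ (fun ω => ω.2.1) Prod.fst (fun ω => ω.2.2)
  have h3 := entropyOf_comp_injective μ (fun ω => (ω.1, ω.2.1, ω.2.2))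
    (f := fun w => (w.2.1, w.1, w.2.2)) fun _ _ h => by simp_all [Prod.ext_iff]
  have h4 := entropyOf_comp_injective μ (fun ω => (ω.1, ω.2.1))
    (f := Prod.swap) Prod.swap_injective
  simp only [Prod.swap_prod_mk] at h3 h4
  have i1 := mul_le_of_le_one_left (infoOf_nonneg μ Prod.fst (fun ω => ω.2.1)) h₁
  have i2 := mul_le_of_le_one_left (infoOf_nonneg μ Prod.fst (fun ω => ω.2.2)) h₂
  have i3 : infoOf μ Prod.fst (fun ω => ω.2.1) + infoOf μ Prod.fst (fun ω => ω.2.2) ≤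
      infoOf μ Prod.fst (fun ω => (ω.2.1, ω.2.2)) := by
    unfold infoOf
    linarith
  linarith

theorem withAux_eq_map_compProd (r : PMF Ω) (K : Ω → PMF Ω') :
    withAux r K = (compProd r K).map Prod.swap := by
  simp [withAux, compProd, PMF.map_bind, PMF.map_comp, Function.comp_def]

theorem withAux_map {U : Type*} (r : PMF Ω) (g : Ω → Ω') (K : Ω' → PMF U) :
    withAux (r.map g) K = (withAux r fun a => K (g a)).map (Prod.map id g) := by
  simp [withAux, PMF.bind_map, PMF.map_bind, PMF.map_comp, Function.comp_def]

theorem infoOf_withAux (r : PMF α) (K : α → PMF γ) :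
    infoOf (withAux r K) Prod.fst Prod.snd =
      entropy (r.bind K) - ∑ v, (r v).toReal * entropy (K v) := by
  have h1 := entropyOf_comp_injective (compProd r K) id Prod.swap_injective
  have h2 : entropyOf (compProd r K) id = entropy (compProd r K) := by
    rw [entropyOf, PMF.map_id]
  have h3 : entropyOf (compProd r K) Prod.fst = entropy r := by
    rw [entropyOf, compProd_map_fst]
  have h4 : entropyOf (compProd r K) Prod.snd = entropy (r.bind K) := by
    rw [entropyOf, compProd_map_snd]
  rw [withAux_eq_map_compProd, infoOf_map, infoOf]
  change entropyOf _ Prod.snd + entropyOf _ Prod.fst - entropyOf _ (fun z => Prod.swap (id z)) = _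
  rw [h1, h2, h3, h4, entropy_compProd]
  ring

/-- `U` sees its argument only through `g`. The information is the entropy of `U` minus the mean
kernel entropy, and both are unchanged when the law is pushed forward along `g`. -/
theorem infoOf_withAux_comp (r : PMF α) (g : α → β) (K : β → PMF γ) :
    infoOf (withAux r fun a => K (g a)) Prod.fst (fun w => g w.2) =
      infoOf (withAux r fun a => K (g a)) Prod.fst Prod.snd := by
  have h := infoOf_map (withAux r fun a => K (g a)) (Prod.map id g) Prod.fst Prod.snd
  rw [← withAux_map, infoOf_withAux, PMF.bind_map, sum_toReal_map_mul] at h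
  rw [infoOf_withAux]
  exact h.symm

variable {Z₁ Z₂ T₁ T₂ S₁ S₂ : Type*} [Fintype Z₁] [Fintype Z₂] [Fintype T₁] [Fintype T₂]
  [Fintype S₁] [Fintype S₂]

/-- Local processing. -/
theorem GNonpos.map {l₁ l₂ : ℝ} (h₁ : 0 ≤ l₁) (h₂ : 0 ≤ l₂) {r : PMF (Y₁ × Y₂)}
    (hr : GNonpos l₁ l₂ r) (g₁ : Y₁ → Z₁) (g₂ : Y₂ → Z₂) :
    GNonpos l₁ l₂ (r.map (Prod.map g₁ g₂)) := by
  intro k K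
  have h := hr k fun y => K (Prod.map g₁ g₂ y)
  rw [gValue_eq_gOf] at h ⊢
  rw [withAux_map, gOf_map]
  set μ := withAux r fun y => K (Prod.map g₁ g₂ y) with hμ
  -- The term with the negative sign is preserved exactly; only the two marginal terms undergo data
  -- processing.
  have e : infoOf μ Prod.fst (fun w => (g₁ w.2.1, g₂ w.2.2)) =
      infoOf μ Prod.fst (fun w => (w.2.1, w.2.2)) := infoOf_withAux_comp r (Prod.map g₁ g₂) K
  have i1 := mul_le_mul_of_nonneg_left (infoOf_comp_le μ Prod.fst (fun w => w.2.1) g₁) h₁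
  have i2 := mul_le_mul_of_nonneg_left (infoOf_comp_le μ Prod.fst (fun w => w.2.2) g₂) h₂
  change - infoOf μ Prod.fst (fun w => (g₁ w.2.1, g₂ w.2.2)) +
    l₁ * infoOf μ Prod.fst (fun w => g₁ w.2.1) + l₂ * infoOf μ Prod.fst (fun w => g₂ w.2.2) ≤ 0
  unfold gOf at h
  linarith

/-- Extension by a no-signalling kernel. -/
theorem GNonpos.extend {l₁ l₂ : ℝ} (h₁ : 0 ≤ l₁) (h₂ : 0 ≤ l₂) {r : PMF (S₁ × S₂)}
    (hr : GNonpos l₁ l₂ r) {W : S₁ × S₂ → PMF (T₁ × T₂)} (hW : ∀ s, GNonpos l₁ l₂ (W s))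
    {W₁ : S₁ → PMF T₁} {W₂ : S₂ → PMF T₂} (hW₁ : ∀ s, (W s).map Prod.fst = W₁ s.1)
    (hW₂ : ∀ s, (W s).map Prod.snd = W₂ s.2) :
    GNonpos l₁ l₂ ((compProd r W).map fun z => ((z.1.1, z.2.1), (z.1.2, z.2.2))) := by
  intro k K
  set K' : (S₁ × S₂) → T₁ × T₂ → PMF (Fin k) := fun s t => K ((s.1, t.1), (s.2, t.2)) with hK'
  set V : S₁ × S₂ → PMF (Fin k × (T₁ × T₂)) := fun s => withAux (W s) (K' s) with hV
  set μ := compProd r V with hμ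
  have hVsnd : ∀ s, (V s).map Prod.snd = W s := by
    intro s
    have h : ∀ v, (K' s v).map (fun _ => v) = PMF.pure v := fun v => PMF.map_const _ _
    simp [hV, withAux, PMF.map_bind, PMF.map_comp, Function.comp_def, h]
  have e1 : withAux ((compProd r W).map fun z => ((z.1.1, z.2.1), (z.1.2, z.2.2))) K =
      μ.map fun z => (z.2.1, ((z.1.1, z.2.2.1), (z.1.2, z.2.2.2))) := by
    simp [hμ, hV, hK', withAux, compProd, PMF.map_bind, PMF.bind_map, PMF.bind_bind,
      PMF.map_comp, Function.comp_def]
  have e2 : withAux r (fun s => (V s).map Prod.fst) = μ.map fun z => (z.2.1, z.1) := by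
    simp [hμ, withAux, compProd, PMF.map_bind, PMF.map_comp, Function.comp_def]
  -- For the base law, the auxiliary kernel is `K` averaged over `T` given `S`.
  have a := hr k fun s => (V s).map Prod.fst
  rw [gValue_eq_gOf, e2, gOf_map] at a
  rw [gValue_eq_gOf, e1, gOf_map]
  have b : ∑ s, (r s).toReal * gOf l₁ l₂ (V s) Prod.fst (fun w => w.2.1) (fun w => w.2.2) ≤ 0 :=
    Finset.sum_nonpos fun s _ => mul_nonpos_of_nonneg_of_nonpos ENNReal.toReal_nonneg <| by
      rw [← gValue_eq_gOf]; exact hW s k _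
  have c := infoOf_compProd r V Prod.fst fun w => (w.2.1, w.2.2)
  have c' := infoOf_comp_injective μ (fun z => z.2.1) (fun z => (z.1, (z.2.2.1, z.2.2.2)))
    (f := fun v : (S₁ × S₂) × (T₁ × T₂) => ((v.1.1, v.2.1), (v.1.2, v.2.2)))
    fun _ _ h => by simp_all [Prod.ext_iff]
  have d₁ := infoOf_compProd_le r V Prod.fst (fun w => w.2.1) Prod.fst W₁ fun s => by
    rw [← hW₁, ← hVsnd, PMF.map_comp]; rfl
  have d₂ := infoOf_compProd_le r V Prod.fst (fun w => w.2.2) Prod.snd W₂ fun s => by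
    rw [← hW₂, ← hVsnd, PMF.map_comp]; rfl
  have d₁' := mul_le_mul_of_nonneg_left d₁ h₁
  have d₂' := mul_le_mul_of_nonneg_left d₂ h₂
  simp only [gOf, mul_add, Finset.sum_add_distrib, mul_neg, Finset.sum_neg_distrib,
    mul_left_comm _ l₁, mul_left_comm _ l₂, ← Finset.mul_sum] at b
  simp only [gOf] at a ⊢
  simp only [mul_add] at d₁' d₂'
  change infoOf μ _ _ = infoOf μ _ _ + _ at c
  linarith

end Info

/-! ### Interactive protocols -/

section Interact

variable {X₁ X₂ Y₁ Y₂ A₁ A₂ B₁ B₂ : Type*} [Fintype X₁] [Fintype X₂] [Fintype Y₁] [Fintype Y₂]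
  [Fintype B₁] [Fintype B₂]

/-- The law of the output of either party depends only on the input of this party. -/
def NoSignalling (p : Channel X₁ X₂ Y₁ Y₂) : Prop :=
  (∀ x₁ x₂ x₂', (p x₁ x₂).map Prod.fst = (p x₁ x₂').map Prod.fst) ∧
    ∀ x₁ x₁' x₂, (p x₁ x₂).map Prod.snd = (p x₁' x₂).map Prod.snd

theorem GNonpos.interact {l₁ l₂ : ℝ} (h₁ : l₁ ∈ Set.Icc (0 : ℝ) 1) (h₂ : l₂ ∈ Set.Icc (0 : ℝ) 1)
    {p : Channel X₁ X₂ Y₁ Y₂} (hns : NoSignalling p) (hp : ∀ x₁ x₂, GNonpos l₁ l₂ (p x₁ x₂))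
    (f₁ : Strategy X₁ Y₁) (f₂ : Strategy X₂ Y₂) (n : ℕ) :
    GNonpos l₁ l₂ (interact p f₁ f₂ n) := by
  induction n with
  | zero =>
    have e : TwoWay.interact p f₁ f₂ 0 =
        compProd (PMF.pure Fin.elim0) fun _ => PMF.pure Fin.elim0 := by
      simp [TwoWay.interact, compProd, PMF.pure_map]
    rw [e]
    exact GNonpos.prod h₁.2 h₂.2 _ _
  | succ n ih =>
    obtain ⟨x₁⟩ : Nonempty X₁ := ⟨(f₁ n ((TwoWay.interact p f₁ f₂ n).support_nonempty.some).1
      ).support_nonempty.some⟩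
    obtain ⟨x₂⟩ : Nonempty X₂ := ⟨(f₂ n ((TwoWay.interact p f₁ f₂ n).support_nonempty.some).2
      ).support_nonempty.some⟩
    -- By no-signalling, the reference inputs `x₁` and `x₂` are immaterial.
    set W₁ : X₁ → PMF Y₁ := fun x => (p x x₂).map Prod.fst with hW₁
    set W₂ : X₂ → PMF Y₂ := fun x => (p x₁ x).map Prod.snd with hW₂
    have hp₁ : ∀ x : X₁ × X₂, (p x.1 x.2).map Prod.fst = W₁ x.1 := fun x => hns.1 _ _ _
    have hp₂ : ∀ x : X₁ × X₂, (p x.1 x.2).map Prod.snd = W₂ x.2 := fun x => hns.2 _ _ _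
    -- One round given the past, itself an extension: independent inputs followed by the channel.
    set V : History X₁ Y₁ n × History X₂ Y₂ n → PMF ((X₁ × Y₁) × (X₂ × Y₂)) := fun h =>
      (compProd (compProd (f₁ n h.1) fun _ => f₂ n h.2) fun x => p x.1 x.2).map
        fun z => ((z.1.1, z.2.1), (z.1.2, z.2.2)) with hV
    have hVg : ∀ h, GNonpos l₁ l₂ (V h) := fun h =>
      (GNonpos.prod h₁.2 h₂.2 _ _).extend h₁.1 h₂.1 (fun x => hp x.1 x.2) hp₁ hp₂
    have hV₁ : ∀ h, (V h).map Prod.fst = compProd (f₁ n h.1) W₁ := fun h => by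
      have : ∀ a b, (p a b).map (fun y => (a, y.1)) = (W₁ a).map (fun y => (a, y)) := fun a b => by
        rw [← hp₁ (a, b), PMF.map_comp]; rfl
      simp [hV, compProd, PMF.map_bind, PMF.map_comp, PMF.bind_map, Function.comp_def, this]
    have hV₂ : ∀ h, (V h).map Prod.snd = compProd (f₂ n h.2) W₂ := fun h => by
      have : ∀ a b, (p a b).map (fun y => (b, y.2)) = (W₂ b).map (fun y => (b, y)) := fun a b => by
        rw [← hp₂ (a, b), PMF.map_comp]; rfl
      simp [hV, compProd, PMF.map_bind, PMF.map_comp, PMF.bind_map, Function.comp_def, this]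
    have := (ih.extend h₁.1 h₂.1 hVg (W₁ := fun h => compProd (f₁ n h) W₁)
      (W₂ := fun h => compProd (f₂ n h) W₂) hV₁ hV₂).map h₁.1 h₂.1
      (fun w : History X₁ Y₁ n × (X₁ × Y₁) => Fin.snoc (α := fun _ => X₁ × Y₁) w.1 w.2)
      (fun w : History X₂ Y₂ n × (X₂ × Y₂) => Fin.snoc (α := fun _ => X₂ × Y₂) w.1 w.2)
    convert this using 1
    simp [TwoWay.interact, hV, compProd, PMF.map_bind, PMF.map_comp, PMF.bind_map,
      Function.comp_def]

theorem GNonpos.induced {l₁ l₂ : ℝ} (h₁ : l₁ ∈ Set.Icc (0 : ℝ) 1) (h₂ : l₂ ∈ Set.Icc (0 : ℝ) 1)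
    {p : Channel X₁ X₂ Y₁ Y₂} (hns : NoSignalling p) (hp : ∀ x₁ x₂, GNonpos l₁ l₂ (p x₁ x₂))
    {n : ℕ} (c : SimCode X₁ X₂ Y₁ Y₂ A₁ A₂ B₁ B₂ n) (a₁ : A₁) (a₂ : A₂) :
    GNonpos l₁ l₂ (c.induced p a₁ a₂) := by
  have := ((GNonpos.interact h₁ h₂ hns hp (c.enc₁ a₁) (c.enc₂ a₂) n).extend h₁.1 h₂.1
    (W := fun h => compProd (c.dec₁ a₁ h.1) fun _ => c.dec₂ a₂ h.2)
    (W₁ := c.dec₁ a₁) (W₂ := c.dec₂ a₂) (fun h => GNonpos.prod h₁.2 h₂.2 _ _)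
    (fun h => compProd_map_fst _ _) fun h => by rw [compProd_map_snd, PMF.bind_const]).map
    h₁.1 h₂.1 Prod.snd Prod.snd
  convert this using 1
  simp [SimCode.induced, compProd, PMF.map_bind, PMF.map_comp, Function.comp_def]

/-! ### Passage to the limit in the simulation error -/

theorem tendsto_entropyOf {α Ω ι : Type*} [Fintype α] [Fintype Ω] {F : Filter ι} {r : ι → PMF Ω}
    {s : PMF Ω} (h : ∀ v, Tendsto (fun i => (r i v).toReal) F (𝓝 (s v).toReal)) (X : Ω → α) :
    Tendsto (fun i => entropyOf (r i) X) F (𝓝 (entropyOf s X)) := by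
  classical
  simp only [entropyOf, entropy, toReal_map_apply]
  refine tendsto_finsetSum _ fun a _ => (Real.continuous_negMulLog.tendsto _).comp ?_
  refine tendsto_finsetSum _ fun v _ => ?_
  by_cases hv : X v = a
  · simpa [hv] using h v
  · simpa [hv] using tendsto_const_nhds

/-- For each fixed auxiliary kernel the functional is continuous in the law, so no continuity of the
supremum is needed. -/
theorem GNonpos.of_tendsto {ι : Type*} {F : Filter ι} [F.NeBot] {l₁ l₂ : ℝ}
    {r : ι → PMF (Y₁ × Y₂)} {s : PMF (Y₁ × Y₂)}
    (h : ∀ v, Tendsto (fun i => (r i v).toReal) F (𝓝 (s v).toReal))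
    (hr : ∀ i, GNonpos l₁ l₂ (r i)) : GNonpos l₁ l₂ s := by
  intro k K
  have h' : ∀ v, Tendsto (fun i => (withAux (r i) K v).toReal) F (𝓝 (withAux s K v).toReal) := by
    rintro ⟨u, v⟩
    have e : ∀ q : PMF (Y₁ × Y₂), (withAux q K (u, v)).toReal = (q v).toReal * (K v u).toReal := by
      intro q
      rw [withAux_eq_map_compProd, ← toReal_compProd_apply]
      exact toReal_map_injective (compProd q K) Prod.swap_injective (v, u)
    simp only [e]
    exact (h v).mul_const _
  refine le_of_tendsto (f := fun i => gValue l₁ l₂ (r i) K) (x := F) ?_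
    (Eventually.of_forall fun i => hr i k K)
  simp only [gValue_eq_gOf, gOf, infoOf]
  refine (Tendsto.add ?_ (Tendsto.const_mul _ ?_)).add (Tendsto.const_mul _ ?_)
  · exact (((tendsto_entropyOf h' _).add (tendsto_entropyOf h' _)).sub
      (tendsto_entropyOf h' _)).neg
  · exact ((tendsto_entropyOf h' _).add (tendsto_entropyOf h' _)).sub (tendsto_entropyOf h' _)
  · exact ((tendsto_entropyOf h' _).add (tendsto_entropyOf h' _)).sub (tendsto_entropyOf h' _)

theorem upsilon_subset_of_canSimulate {p : Channel X₁ X₂ Y₁ Y₂} {q : Channel A₁ A₂ B₁ B₂}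
    (hns : NoSignalling p) (hsim : CanSimulate p q) : upsilon p ⊆ upsilon q := by
  rintro ⟨l₁, l₂⟩ ⟨h₁, h₂, hp⟩
  refine ⟨h₁, h₂, ?_⟩
  rw [gChannel_nonpos_iff] at hp ⊢
  intro a₁ a₂
  choose n c hc using fun m : ℕ => hsim (1 / ((m : ℝ) + 1)) Nat.one_div_pos_of_nat
  refine GNonpos.of_tendsto (F := atTop) (r := fun m => (c m).induced p a₁ a₂) (fun b => ?_)
    fun m => GNonpos.induced h₁ h₂ hns hp (c m) a₁ a₂
  exact tendsto_iff_norm_sub_tendsto_zero.2 <| squeeze_zero (fun _ => norm_nonneg _)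
    (fun m => hc m a₁ a₂ b) tendsto_one_div_add_atTop_nhds_zero_nat

end Interact

/-! ### Coding at a positive rate over a signalling channel -/

section Coding

/-- Greedy selection: each new word is at most as close to the chosen ones as an average word is.
Words may repeat; `D` then counts them at their own diagonal value. -/
theorem exists_code_of_average {A : Type*} [Fintype A] [Nonempty A] (D : A → A → ℝ)
    (hsymm : ∀ a b, D a b = D b a) {κ : ℝ} (hκ : 0 ≤ κ)
    (hD : ∀ b, ∑ a, D a b ≤ Fintype.card A * κ) (M : ℕ) :
    ∃ w : Fin M → A, ∑ m, ∑ m', (if m = m' then 0 else D (w m) (w m')) ≤ M ^ 2 * κ := by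
  induction M with
  | zero => exact ⟨Fin.elim0, by simp⟩
  | succ M ih =>
    obtain ⟨w, hw⟩ := ih
    obtain ⟨a, -, ha⟩ : ∃ a ∈ (Finset.univ : Finset A), ∑ m, D a (w m) ≤ M * κ := by
      refine Finset.exists_le_of_sum_le Finset.univ_nonempty ?_
      rw [Finset.sum_comm]
      refine (Finset.sum_le_sum fun m _ => hD (w m)).trans_eq ?_
      simp only [Finset.sum_const, Finset.card_univ, Fintype.card_fin, nsmul_eq_mul]
      ring
    refine ⟨Fin.cons a w, ?_⟩
    simp only [Fin.sum_univ_succ, Fin.cons_zero, Fin.cons_succ, if_true, Fin.succ_ne_zero,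
      if_false, (Fin.succ_ne_zero _).symm, Fin.succ_inj, zero_add, Finset.sum_add_distrib]
    simp only [hsymm (w _) a]
    push_cast
    -- By symmetry the new word adds at most `2 * M * κ`, below `((M + 1) ^ 2 - M ^ 2) * κ`.
    nlinarith

variable {Z : Type*} [Fintype Z]

/-- The Bhattacharyya coefficient of two distributions. -/
noncomputable def bhatt (r s : PMF Z) : ℝ := ∑ z, √((r z).toReal * (s z).toReal)

theorem bhatt_self (r : PMF Z) : bhatt r r = 1 := by
  simp [bhatt, Real.sqrt_mul_self, sum_toReal]

theorem bhatt_comm (r s : PMF Z) : bhatt r s = bhatt s r := by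
  simp only [bhatt, mul_comm]

theorem bhatt_nonneg (r s : PMF Z) : 0 ≤ bhatt r s :=
  Finset.sum_nonneg fun _ _ => Real.sqrt_nonneg _

theorem bhatt_lt_one {r s : PMF Z} (h : r ≠ s) : bhatt r s < 1 := by
  obtain ⟨z, hz⟩ := DFunLike.ne_iff.1 h
  -- One minus the coefficient is half the sum of the squares `(√r - √s) ^ 2`, the Hellinger
  -- distance.
  have e : ∀ z, √((r z).toReal * (s z).toReal) =
      ((r z).toReal + (s z).toReal - (√(r z).toReal - √(s z).toReal) ^ 2) / 2 := by
    intro z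
    rw [Real.sqrt_mul ENNReal.toReal_nonneg, sub_sq, Real.sq_sqrt ENNReal.toReal_nonneg,
      Real.sq_sqrt ENNReal.toReal_nonneg]
    ring
  have pos : 0 < ∑ z, (√(r z).toReal - √(s z).toReal) ^ 2 := by
    refine Finset.sum_pos' (fun _ _ => sq_nonneg _) ⟨z, Finset.mem_univ z, ?_⟩
    refine sq_pos_of_ne_zero (sub_ne_zero.2 fun hs => hz ?_)
    rw [Real.sqrt_inj ENNReal.toReal_nonneg ENNReal.toReal_nonneg] at hs
    exact (ENNReal.toReal_eq_toReal_iff' (r.apply_ne_top z) (s.apply_ne_top z)).1 hs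
  simp only [bhatt, e, ← Finset.sum_div, Finset.sum_sub_distrib, Finset.sum_add_distrib,
    sum_toReal]
  linarith

/-- Over a binary input channel with distinct output distributions there are codes whose error
probability decays exponentially in the length and grows at most linearly in the size. -/
theorem exists_binary_code {v : Bool → PMF Z} (hv : v false ≠ v true) :
    ∃ ρ : ℝ, 0 < ρ ∧ ρ < 1 ∧ ∀ n M : ℕ, 0 < M →
      ∃ (w : Fin M → Fin n → Bool) (dec : (Fin n → Z) → Fin M),
        ∑ m, ∑ z, (if dec z ≠ m then ∏ i, (v (w m i) (z i)).toReal else 0) ≤ M ^ 2 * ρ ^ n := by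
  classical
  have hβ := bhatt_lt_one hv
  have hβ0 := bhatt_nonneg (v false) (v true)
  set β := bhatt (v false) (v true) with hβdef
  -- The mean coefficient between a fixed letter and a uniform one: it is `1` if they agree and `β`
  -- if not.
  refine ⟨(1 + β) / 2, by linarith, by linarith, fun n M hM => ?_⟩
  have hD : ∀ b : Fin n → Bool, ∑ a : Fin n → Bool, ∏ i, bhatt (v (a i)) (v (b i)) ≤
      Fintype.card (Fin n → Bool) * ((1 + β) / 2) ^ n := by
    intro b
    have h := Finset.prod_univ_sum (fun _ : Fin n => (Finset.univ : Finset Bool))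
      fun i t => bhatt (v t) (v (b i))
    rw [Fintype.piFinset_univ] at h
    rw [← h]
    have hb : ∀ t : Bool, ∑ s, bhatt (v s) (v t) = 1 + β := by
      intro t
      cases t <;> simp [bhatt_self, hβdef, bhatt_comm (v true) (v false), add_comm]
    simp only [hb, Finset.prod_const, Finset.card_univ, Fintype.card_fin, Fintype.card_fun,
      Fintype.card_bool, Nat.cast_pow, Nat.cast_ofNat, ← mul_pow]
    exact le_of_eq (by ring)
  obtain ⟨w, hw⟩ := exists_code_of_average (fun a b : Fin n → Bool => ∏ i, bhatt (v (a i)) (v (b i)))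
    (fun a b => by simp only [bhatt_comm]) (by positivity) hD M
  have : Nonempty (Fin M) := ⟨⟨0, hM⟩⟩
  -- Maximum likelihood decoding.
  have hmax : ∀ z : Fin n → Z, ∃ m, ∀ m', ∏ i, (v (w m' i) (z i)).toReal ≤
      ∏ i, (v (w m i) (z i)).toReal := fun z =>
    Finite.exists_max fun m => ∏ i, (v (w m i) (z i)).toReal
  choose dec hdec using hmax
  refine ⟨w, dec, le_trans (Finset.sum_le_sum fun m _ => ?_) hw⟩
  have hprod : ∀ m m', ∏ i, bhatt (v (w m i)) (v (w m' i)) =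
      ∑ z : Fin n → Z, ∏ i, √((v (w m i) (z i)).toReal * (v (w m' i) (z i)).toReal) := by
    intro m m'
    have h := Finset.prod_univ_sum (fun _ : Fin n => (Finset.univ : Finset Z))
      fun i t => √((v (w m i) t).toReal * (v (w m' i) t).toReal)
    rw [Fintype.piFinset_univ] at h
    exact h
  have hsum : ∑ m', (if m = m' then 0 else ∏ i, bhatt (v (w m i)) (v (w m' i))) =
      ∑ z : Fin n → Z, ∑ m', if m = m' then 0 else
        ∏ i, √((v (w m i) (z i)).toReal * (v (w m' i) (z i)).toReal) := by
    rw [Finset.sum_comm]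
    refine Finset.sum_congr rfl fun m' _ => ?_
    split_ifs with h
    · simp
    · exact hprod m m'
  rw [hsum]
  refine Finset.sum_le_sum fun z _ => ?_
  have hnn : ∀ m', 0 ≤ if m = m' then 0 else
      ∏ i, √((v (w m i) (z i)).toReal * (v (w m' i) (z i)).toReal) := fun m' => by
    split_ifs
    · exact le_rfl
    · exact Finset.prod_nonneg fun _ _ => Real.sqrt_nonneg _
  split_ifs with h
  · refine le_trans ?_ (Finset.single_le_sum (fun m' _ => hnn m') (Finset.mem_univ (dec z)))
    rw [if_neg (Ne.symm h)]
    -- On an error the decoded word is at least as likely as the sent one, so the sent likelihood is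
    -- at most the geometric mean of the two.
    refine le_of_sq_le_sq ?_ (Finset.prod_nonneg fun _ _ => Real.sqrt_nonneg _)
    have hs : (∏ i, √((v (w m i) (z i)).toReal * (v (w (dec z) i) (z i)).toReal)) ^ 2 =
        (∏ i, (v (w m i) (z i)).toReal) * ∏ i, (v (w (dec z) i) (z i)).toReal := by
      rw [← Finset.prod_pow, ← Finset.prod_mul_distrib]
      exact Finset.prod_congr rfl fun i _ =>
        Real.sq_sqrt (mul_nonneg ENNReal.toReal_nonneg ENNReal.toReal_nonneg)
    rw [hs, sq]
    exact mul_le_mul_of_nonneg_left (hdec z m)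
      (Finset.prod_nonneg fun _ _ => ENNReal.toReal_nonneg)
  · exact Finset.sum_nonneg fun m' _ => hnn m'

/-- As `R` decreases to `0`, `2 ^ R * ρ` tends to `ρ < 1`; the ceiling costs at most a factor `2`.
-/
theorem exists_rate {ρ : ℝ} (h0 : 0 < ρ) (h1 : ρ < 1) :
    ∃ R : ℝ, 0 < R ∧
      Tendsto (fun n : ℕ => ((2 ^ ⌈(n : ℝ) * R⌉₊ : ℕ) : ℝ) * ρ ^ n) atTop (𝓝 0) := by
  have hcont : Tendsto (fun R : ℝ => (2 : ℝ) ^ R * ρ) (𝓝[>] 0) (𝓝 ρ) := by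
    have : ContinuousAt (fun R : ℝ => (2 : ℝ) ^ R * ρ) 0 :=
      (Real.continuousAt_const_rpow (by norm_num)).mul_const ρ
    have := this.tendsto
    simp only [Real.rpow_zero, one_mul] at this
    exact this.mono_left nhdsWithin_le_nhds
  obtain ⟨R, hR, hpos⟩ := ((hcont.eventually_lt_const h1).and self_mem_nhdsWithin).exists
  have hpos : 0 < R := hpos
  refine ⟨R, hpos, squeeze_zero (g := fun n : ℕ => 2 * ((2 : ℝ) ^ R * ρ) ^ n)
    (fun n => by positivity) (fun n => ?_) ?_⟩
  · have h := (Nat.ceil_lt_add_one (mul_nonneg n.cast_nonneg hpos.le)).le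
    have h2 : ((2 : ℝ) ^ ⌈(n : ℝ) * R⌉₊) ≤ 2 * ((2 : ℝ) ^ R) ^ n := by
      rw [← Real.rpow_natCast, ← Real.rpow_natCast, ← Real.rpow_mul (by norm_num)]
      refine (Real.rpow_le_rpow_of_exponent_le (by norm_num) h).trans_eq ?_
      rw [Real.rpow_add (by norm_num), Real.rpow_one, mul_comm, mul_comm R]
    push_cast
    rw [mul_pow, ← mul_assoc]
    exact mul_le_mul_of_nonneg_right h2 (by positivity)
  · have := (tendsto_pow_atTop_nhds_zero_of_lt_one (by positivity) hR).const_mul 2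
    simpa using this

/-! ### From binary codes to codes for the two-way channel -/

variable {X₁ X₂ Y₁ Y₂ : Type*}

/-- The law of a single-letter function of the outputs, when the inputs are deterministic. -/
theorem interact_pure_map_apply (p : Channel X₁ X₂ Y₁ Y₂) (c₁ : ℕ → X₁) (c₂ : ℕ → X₂)
    (g : Y₁ × Y₂ → Z) (n : ℕ) (z : Fin n → Z) :
    ((interact p (fun j _ => PMF.pure (c₁ j)) (fun j _ => PMF.pure (c₂ j)) n).map
        (fun h i => g ((h.1 i).2, (h.2 i).2)) z).toReal =
      ∏ i : Fin n, ((p (c₁ i) (c₂ i)).map g (z i)).toReal := by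
  induction n with
  | zero =>
    have e : z = fun i => g (((Fin.elim0 : History X₁ Y₁ 0) i).2,
        ((Fin.elim0 : History X₂ Y₂ 0) i).2) := Subsingleton.elim _ _
    simp [interact, PMF.pure_map, ← e]
  | succ n ih =>
    set r := (interact p (fun j _ => PMF.pure (c₁ j)) (fun j _ => PMF.pure (c₂ j)) n).map
        (fun h i => g ((h.1 i).2, (h.2 i).2)) with hr
    set f : (Fin n → Z) × Z → (Fin (n + 1) → Z) := fun w => Fin.snoc (α := fun _ => Z) w.1 w.2
      with hf
    have hinj : f.Injective := by
      intro a b hab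
      exact Prod.ext_iff.2 (Fin.snoc_injective2 hab)
    have hz : z = f (Fin.init z, z (Fin.last n)) := (Fin.snoc_init_self z).symm
    have e : (interact p (fun j _ => PMF.pure (c₁ j)) (fun j _ => PMF.pure (c₂ j)) (n + 1)).map
        (fun h i => g ((h.1 i).2, (h.2 i).2)) =
          (compProd r fun _ => (p (c₁ n) (c₂ n)).map g).map f := by
      have hs : ∀ (h : History X₁ Y₁ n × History X₂ Y₂ n) (y : Y₁ × Y₂),
          (fun i => g ((Fin.snoc (α := fun _ => X₁ × Y₁) h.1 (c₁ n, y.1) i).2,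
            (Fin.snoc (α := fun _ => X₂ × Y₂) h.2 (c₂ n, y.2) i).2)) =
          f (fun i => g ((h.1 i).2, (h.2 i).2), g y) := by
        intro h y
        funext i
        refine Fin.lastCases ?_ (fun i => ?_) i <;> simp [hf]
      simp only [hr, interact, compProd, PMF.map_bind, PMF.map_comp, PMF.bind_map, PMF.pure_bind,
        Function.comp_def]
      exact congrArg _ (funext fun h => congrArg (fun F => PMF.map F _) (funext (hs h)))
    rw [e, hz, toReal_map_injective _ hinj, toReal_compProd_apply, ih, Fin.prod_univ_castSucc]
    simp [hf]

/-- Extension of a codeword to all times. -/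
def extendWord {n : ℕ} (w : Fin n → Bool) (j : ℕ) : Bool := if h : j < n then w ⟨j, h⟩ else false

theorem extendWord_apply {n : ℕ} (w : Fin n → Bool) (i : Fin n) : extendWord w i = w i := by
  simp [extendWord]

open Classical in
theorem toReal_toOuterMeasure_map {Ω : Type*} (r : PMF Ω) (f : Ω → Z) (P : Z → Prop) :
    (r.toOuterMeasure {ω | P (f ω)}).toReal = ∑ z, if P z then (r.map f z).toReal else 0 := by
  have h := r.toOuterMeasure_map_apply f {z | P z}
  rw [Set.preimage_ofPred_eq] at h
  rw [← h, PMF.toOuterMeasure_apply_fintype, ENNReal.toReal_sum]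
  · refine Finset.sum_congr rfl fun z _ => ?_
    by_cases hz : P z <;> simp [hz]
  · exact fun z _ => ne_top_of_le_ne_top (PMF.apply_ne_top _ z) (Set.indicator_le_self _ _ z)

theorem errorProb_nonneg {M₁ M₂ n : ℕ} (c : Code X₁ X₂ Y₁ Y₂ M₁ M₂ n)
    (p : Channel X₁ X₂ Y₁ Y₂) : 0 ≤ c.errorProb p :=
  div_nonneg (Finset.sum_nonneg fun _ _ => Finset.sum_nonneg fun _ _ => ENNReal.toReal_nonneg)
    (by positivity)

/-- Party 1 keeps its input fixed while party 2 sends binary codewords without using feedback. The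
equation `M₁ = 1` is a hypothesis so that the code type matches the size `2 ^ ⌈n * 0⌉₊` in
`Achievable`. -/
theorem exists_code_second [Fintype Y₁] {p : Channel X₁ X₂ Y₁ Y₂} {x₁ : X₁} {x₂ x₂' : X₂}
    (h : (p x₁ x₂).map Prod.fst ≠ (p x₁ x₂').map Prod.fst) :
    ∃ ρ : ℝ, 0 < ρ ∧ ρ < 1 ∧ ∀ n M₁ M₂ : ℕ, M₁ = 1 → 0 < M₂ →
      ∃ c : Code X₁ X₂ Y₁ Y₂ M₁ M₂ n, c.errorProb p ≤ M₂ * ρ ^ n := by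
  classical
  set x : Bool → X₂ := fun b => if b then x₂' else x₂ with hx
  obtain ⟨ρ, h0, h1, hc⟩ := exists_binary_code (v := fun b => (p x₁ (x b)).map Prod.fst)
    (by simpa [hx] using h)
  refine ⟨ρ, h0, h1, ?_⟩
  rintro n _ M rfl hM
  obtain ⟨w, dec, hw⟩ := hc n M hM
  refine ⟨⟨fun _ _ _ => x₁, fun m j _ => x (extendWord (w m) j), fun _ y => dec y,
    fun _ _ => 0⟩, ?_⟩
  have hM' : (0 : ℝ) < M := by exact_mod_cast hM
  simp only [Code.errorProb, Code.law, Subsingleton.elim _ (0 : Fin 1), ne_eq, not_true_eq_false,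
    or_false, Finset.univ_unique, Finset.sum_singleton, Nat.cast_one, one_mul]
  rw [div_le_iff₀ hM']
  -- Averaging over the `M` messages turns the bound `M ^ 2 * ρ ^ n` into `M * ρ ^ n`.
  refine le_trans (le_of_eq ?_) (hw.trans_eq (by ring))
  refine Finset.sum_congr rfl fun m _ => ?_
  refine (toReal_toOuterMeasure_map _
    (fun (h : History X₁ Y₁ n × History X₂ Y₂ n) i => (h.1 i).2) fun z => ¬ dec z = m).trans ?_
  refine Finset.sum_congr rfl fun z _ => ?_
  have := interact_pure_map_apply p (fun _ => x₁) (fun j => x (extendWord (w m) j)) Prod.fst n z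
  simp only [extendWord_apply] at this
  rw [this]
  by_cases hd : dec z = m <;> simp [hd]

theorem exists_code_first [Fintype Y₂] {p : Channel X₁ X₂ Y₁ Y₂} {x₁ x₁' : X₁} {x₂ : X₂}
    (h : (p x₁ x₂).map Prod.snd ≠ (p x₁' x₂).map Prod.snd) :
    ∃ ρ : ℝ, 0 < ρ ∧ ρ < 1 ∧ ∀ n M₁ M₂ : ℕ, M₂ = 1 → 0 < M₁ →
      ∃ c : Code X₁ X₂ Y₁ Y₂ M₁ M₂ n, c.errorProb p ≤ M₁ * ρ ^ n := by
  classical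
  set x : Bool → X₁ := fun b => if b then x₁' else x₁ with hx
  obtain ⟨ρ, h0, h1, hc⟩ := exists_binary_code (v := fun b => (p (x b) x₂).map Prod.snd)
    (by simpa [hx] using h)
  refine ⟨ρ, h0, h1, ?_⟩
  rintro n M _ rfl hM
  obtain ⟨w, dec, hw⟩ := hc n M hM
  refine ⟨⟨fun m j _ => x (extendWord (w m) j), fun _ _ _ => x₂, fun _ _ => 0,
    fun _ y => dec y⟩, ?_⟩
  have hM' : (0 : ℝ) < M := by exact_mod_cast hM
  simp only [Code.errorProb, Code.law, Subsingleton.elim _ (0 : Fin 1), ne_eq, not_true_eq_false,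
    false_or, Finset.univ_unique, Finset.sum_singleton, Nat.cast_one, mul_one]
  rw [div_le_iff₀ hM']
  refine le_trans (le_of_eq ?_) (hw.trans_eq (by ring))
  refine Finset.sum_congr rfl fun m _ => ?_
  refine (toReal_toOuterMeasure_map _
    (fun (h : History X₁ Y₁ n × History X₂ Y₂ n) i => (h.2 i).2) fun z => ¬ dec z = m).trans ?_
  refine Finset.sum_congr rfl fun z _ => ?_
  have := interact_pure_map_apply p (fun j => x (extendWord (w m) j)) (fun _ => x₂) Prod.snd n z
  simp only [extendWord_apply] at this
  rw [this]
  by_cases hd : dec z = m <;> simp [hd]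

/-- If a marginal depended on the other party's input, a pair `(0, R)` or `(R, 0)` with `R > 0`
would be achievable. -/
theorem ZeroCapacity.noSignalling [Fintype Y₁] [Fintype Y₂] {p : Channel X₁ X₂ Y₁ Y₂} (hp : ZeroCapacity p) :
    NoSignalling p := by
  have hach : ∀ R, Achievable p R → R = (0, 0) := fun R hR => by
    have : R ∈ capacityRegion p := subset_closure hR
    rwa [hp, Set.mem_singleton_iff] at this
  have hone : ∀ n : ℕ, 2 ^ ⌈(n : ℝ) * 0⌉₊ = 1 := by simp
  constructor
  · intro x₁ x₂ x₂'
    by_contra h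
    obtain ⟨ρ, h0, h1, hc⟩ := exists_code_second h
    obtain ⟨R, hR, ht⟩ := exists_rate h0 h1
    choose c hc using fun n : ℕ => hc n (2 ^ ⌈(n : ℝ) * 0⌉₊) (2 ^ ⌈(n : ℝ) * R⌉₊) (hone n)
      (by positivity)
    exact hR.ne' (congrArg Prod.snd (hach (0, R) ⟨le_rfl, hR.le, c,
      squeeze_zero (fun n => errorProb_nonneg _ _) hc ht⟩))
  · intro x₁ x₁' x₂
    by_contra h
    obtain ⟨ρ, h0, h1, hc⟩ := exists_code_first h
    obtain ⟨R, hR, ht⟩ := exists_rate h0 h1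
    choose c hc using fun n : ℕ => hc n (2 ^ ⌈(n : ℝ) * R⌉₊) (2 ^ ⌈(n : ℝ) * 0⌉₊) (hone n)
      (by positivity)
    exact hR.ne' (congrArg Prod.fst (hach (R, 0) ⟨hR.le, le_rfl, c,
      squeeze_zero (fun n => errorProb_nonneg _ _) hc ht⟩))

end Coding

end TwoWay

theorem mainTheorem6 {X₁ X₂ Y₁ Y₂ A₁ A₂ B₁ B₂ : Type*}
    [Fintype X₁] [Fintype X₂] [Fintype Y₁] [Fintype Y₂]
    [Fintype A₁] [Fintype A₂] [Fintype B₁] [Fintype B₂]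
    (p : TwoWay.Channel X₁ X₂ Y₁ Y₂) (q : TwoWay.Channel A₁ A₂ B₁ B₂)
    (hp : TwoWay.ZeroCapacity p) (hsim : TwoWay.CanSimulate p q) :
    TwoWay.upsilon p ⊆ TwoWay.upsilon q :=
  TwoWay.upsilon_subset_of_canSimulate hp.noSignalling hsim
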